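/- **Theorem (Local Bernstein theory).** There is an absolute constant $C>0$ such that the following holds. Let $I=[a,b]$ with $a<b$, let $y_0, A, \lambda, L>0$, and let $f$ be a complex-valued function that is holomorphic on the closed rectangle $R^+(I,y_0) := \{x+iy : x\in I,\ 0\le y\le y_0\}$ (complex differentiable at every point of the rectangle, where at boundary points the difference quotients are taken within the rectangle; holomorphy on a neighbourhood of the rectangle suffices). Suppose that (a) (Lower edge) $f(x)$ is real with $|f(x)|\le A$ for all $x\in I$; (b) (Upper edge) $|f(x+iy_0)|\le A e^{\lambda y_0}$ for all $x\in I$; (c) (Vertical edges) $|f(x+iy)|\le A\exp\!\left(\lambda y+e^{\pi L/(4y_0)}\right)$ for all $x\in\partial I=\{a,b\}$ and $0\le y\le y_0$. Then for every $x\in I$ with $\mathrm{dist}(x,\partial I)\ge L$: (i) (Local Bernstein inequality) $$|f'(x)|\le A\lambda\left(1+Ce^{-\frac{\pi L}{4y_0}}+\frac{C}{\lambda\min(y_0,L)}\right).$$ (ii) (Local Boas inequality) $$\left|f(x)+\frac{i f'(x)}{\lambda}\right|\le A\left(1+Ce^{-\frac{\pi L}{4y_0}}+\frac{C}{\lambda\min(y_0,L)}\right).$$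 (iii) (Local Duffin–Schaeffer inequality) For every $0\le y\le y_0$, $$|f(x+iy)|\le A\left(1+Ce^{-\frac{\pi L}{4y_0}}\right)\cosh\left(\left(1+\frac{C}{\lambda\min(y_0,L)}\right)\lambda y\right).$$ (iv) (Local linear growth of zeroes) If $f(x)\ne 0$ and $0<r<\min(y_0,L)/4$, then $f$, extended below the real axis by the Schwarz reflection $f(\overline z)=\overline{f(z)}$, is holomorphic on the disk $D(x,r)=\{z:|z-x|<r\}$, has finitely many zeroes there, and the number of these zeroes, counted with multiplicity, is at most $$C\left(1+\lambda r+\log\frac{A}{|f(x)|}\right).$$ -/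

import Mathlib

namespace LocalBernstein

open scoped ComplexConjugate

/-- The closed rectangle `R⁺(J, y₀) = {x + iy : x ∈ J, 0 ≤ y ≤ y₀}`. -/
def upperRectangle (J : Set ℝ) (y₀ : ℝ) : Set ℂ :=
  {z : ℂ | z.re ∈ J ∧ 0 ≤ z.im ∧ z.im ≤ y₀}

/-- The extension of `f` to the lower half-plane by Schwarz reflection,
`f (conj z) = conj (f z)`. If `f` is holomorphic on a connected open set containing both
`R⁺(J, y₀)` and a disk `D(x, r)` centred on `J`, and `f` is real on `J`, then this agrees
with `f` on `D(x, r)` as long as the upper half of the disk lies in the rectangle. -/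
noncomputable def reflectExt (f : ℂ → ℂ) (z : ℂ) : ℂ :=
  if 0 ≤ z.im then f z else conj (f (conj z))

/-- The number of zeroes of `g` in `U`, counted with multiplicity. It is meaningful when `g` is
analytic at the points of `U` and has finitely many zeroes there. -/
noncomputable def zeroCount (g : ℂ → ℂ) (U : Set ℂ) : ℕ :=
  ∑ᶠ z ∈ U, analyticOrderNatAt g z

end LocalBernstein

/-! ### Maximum principle and removal of the vertical edges -/

namespace LocalBernstein

open Complex Set

/-! Multiplying `f` by `exp (iλ(w - x) - M cosh(α(w - x - i y₀/2)))` absorbs the doubly exponential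
growth on the vertical edges. The maximum principle then gives `‖f‖ ≤ B e^{λ y}` within horizontal
distance `L/3` of `x`, with `B = A(1 + O(e^{-πL/(4y₀)}))` (`norm_le_of_boundary_bounds`).

Write `f/B = cos ζ`. The function `|im ζ|` is single-valued and subharmonic, vanishes on the real
edge because `f/B` lies in `[-1, 1]` there, and is at most `λy + 2` everywhere. Comparison with an
explicit harmonic function on a smaller rectangle, carried out with Chebyshev polynomials instead of
subharmonic functions (`abs_im_le_re_of_boundary`), yields `|im ζ| ≤ Λy` above `x`, where `Λ = λ +
O(1/min(y₀, L))` (`abs_im_le_of_norm_le_exp`).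

This one estimate gives (iii) through `|cos ζ| ≤ cosh(im ζ)`. Its first-order form as `y → 0` is `Λ²
f(x)² + f'(x)² ≤ Λ² B²` (`sq_add_sq_le_of_abs_im_le`), which contains both (i) and (ii). For (iv),
only the bound `B e^{λ y}` is needed, with Schwarz reflection and Jensen's inequality. -/

/-- Maximum modulus principle on a closed rectangle. -/
theorem norm_le_of_forall_boundary_reProdIm {F : ℂ → ℂ} {a b c d K : ℝ} (hab : a < b) (hcd : c < d)
    (hF : DifferentiableOn ℂ F (Icc a b ×ℂ Icc c d))
    (hc : ∀ z : ℂ, z.re ∈ Icc a b → z.im = c → ‖F z‖ ≤ K)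
    (hd : ∀ z : ℂ, z.re ∈ Icc a b → z.im = d → ‖F z‖ ≤ K)
    (hs : ∀ z : ℂ, z.re = a ∨ z.re = b → z.im ∈ Icc c d → ‖F z‖ ≤ K)
    {z : ℂ} (hz : z ∈ Icc a b ×ℂ Icc c d) : ‖F z‖ ≤ K := by
  have hcl : closure (Ioo a b ×ℂ Ioo c d) = Icc a b ×ℂ Icc c d := by
    rw [closure_reProdIm, closure_Ioo hab.ne, closure_Ioo hcd.ne]
  have hdc : DiffContOnCl ℂ F (Ioo a b ×ℂ Ioo c d) := by
    refine DifferentiableOn.diffContOnCl ?_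
    rwa [hcl]
  refine Complex.norm_le_of_forall_mem_frontier_norm_le
    ((Metric.isBounded_Ioo a b).reProdIm (Metric.isBounded_Ioo c d)) hdc ?_ (hcl ▸ hz)
  intro w hw
  rw [frontier_reProdIm, closure_Ioo hab.ne, closure_Ioo hcd.ne, frontier_Ioo hab,
    frontier_Ioo hcd] at hw
  simp only [mem_union, mem_reProdIm, mem_insert_iff, mem_singleton_iff] at hw
  rcases hw with ⟨h1, h2 | h2⟩ | ⟨h1, h2⟩
  · exact hc w h1 h2
  · exact hd w h1 h2
  · exact hs w h1 h2

theorem upperRectangle_Icc (a b y₀ : ℝ) :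
    upperRectangle (Icc a b) y₀ = Icc a b ×ℂ Icc 0 y₀ := by
  ext z
  simp [upperRectangle, mem_reProdIm]

/-- `3π/8` is the largest angle met when `α = 3π/(4y₀)` multiplies the distance to the mid-height of
the rectangle. -/
theorem one_fourth_le_cos : (1 / 4 : ℝ) ≤ Real.cos (3 * Real.pi / 8) := by
  have h := Real.one_sub_mul_le_cos (x := 3 * Real.pi / 8) (by positivity) (by linarith [Real.pi_pos])
  have : 2 / Real.pi * (3 * Real.pi / 8) = 3 / 4 := by field_simp; norm_num
  linarith

theorem re_cosh (z : ℂ) : (cosh z).re = Real.cosh z.re * Real.cos z.im := by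
  conv_lhs => rw [← re_add_im z, Complex.cosh_add, cosh_mul_I, sinh_mul_I]
  simp [← ofReal_cosh, ← ofReal_cos, ← ofReal_sinh, ← ofReal_sin]

/-- Convexity: on `[0, 1]` the graph of `exp (K * q)` lies below its chord. -/
theorem exp_mul_le_one_add {K q : ℝ} (hq : 0 ≤ q) (hq1 : q ≤ 1) :
    Real.exp (K * q) ≤ 1 + Real.exp K * q := by
  have h := convexOn_exp.2 (mem_univ 0) (mem_univ K) (sub_nonneg.2 hq1) hq (by ring)
  simp only [smul_eq_mul, mul_zero, zero_add, Real.exp_zero, mul_one] at h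
  rw [mul_comm] at h
  nlinarith

/-- Phragmén–Lindelöf estimate away from the vertical edges of a rectangle. -/
theorem norm_le_of_boundary_bounds {a b y₀ A lam L : ℝ} {f : ℂ → ℂ}
    (hab : a < b) (hy : 0 < y₀) (hA : 0 < A) (hL : 0 < L)
    (hf : DifferentiableOn ℂ f (Icc a b ×ℂ Icc 0 y₀))
    (h0 : ∀ z : ℂ, z.re ∈ Icc a b → z.im = 0 → ‖f z‖ ≤ A)
    (h1 : ∀ z : ℂ, z.re ∈ Icc a b → z.im = y₀ → ‖f z‖ ≤ A * Real.exp (lam * y₀))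
    (h2 : ∀ z : ℂ, z.re = a ∨ z.re = b → z.im ∈ Icc 0 y₀ →
      ‖f z‖ ≤ A * Real.exp (lam * z.im + Real.exp (Real.pi * L / (4 * y₀))))
    {x : ℝ} (hxa : L ≤ x - a) (hxb : L ≤ b - x) {z : ℂ} (hzx : |z.re - x| ≤ L / 3)
    (hz : z.im ∈ Icc 0 y₀) :
    ‖f z‖ ≤ A * (1 + Real.exp 8 * Real.exp (-(Real.pi * L / (4 * y₀)))) *
      Real.exp (lam * z.im) := by
  have hpi := Real.pi_pos
  -- Any rate below `π/y₀` keeps the cosine positive on the strip; it must also exceed `π/(4y₀)` for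
  -- the damping to beat `E`.
  set al : ℝ := 3 * Real.pi / (4 * y₀) with hal
  have hal0 : 0 < al := by positivity
  set E : ℝ := Real.exp (Real.pi * L / (4 * y₀)) with hE
  have hE0 : 0 < E := Real.exp_pos _
  have hcosh : 0 < Real.cosh (al * L) := Real.cosh_pos _
  -- The least `M` for which `cosh ≥ cosh(αL)` and `cos ≥ 1/4` give damping at least `E` on the
  -- vertical edges.
  set M : ℝ := 4 * E / Real.cosh (al * L) with hM
  have hM0 : 0 < M := by positivity
  have hcos : ∀ y ∈ Icc 0 y₀, (1 / 4 : ℝ) ≤ Real.cos (al * (y - y₀ / 2)) := by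
    intro y hy'
    refine one_fourth_le_cos.trans ?_
    rw [← Real.cos_abs (al * _)]
    refine Real.cos_le_cos_of_nonneg_of_le_pi (abs_nonneg _) (by linarith) ?_
    rw [abs_mul, abs_of_pos hal0]
    have : |y - y₀ / 2| ≤ y₀ / 2 := by
      rw [abs_le]; constructor <;> linarith [hy'.1, hy'.2]
    calc al * |y - y₀ / 2| ≤ al * (y₀ / 2) := by gcongr
      _ = 3 * Real.pi / 8 := by rw [hal]; field_simp; norm_num
  let Q : ℂ → ℂ := fun w => I * lam * (w - x) - M * cosh (al * (w - x - y₀ / 2 * I))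
  have hQre : ∀ w : ℂ, (Q w).re = -(lam * w.im) -
      M * (Real.cosh (al * (w.re - x)) * Real.cos (al * (w.im - y₀ / 2))) := by
    intro w
    have e1 : (cosh (al * (w - x - y₀ / 2 * I))).re =
        Real.cosh (al * (w.re - x)) * Real.cos (al * (w.im - y₀ / 2)) := by
      rw [re_cosh]; congr 2 <;> simp
    simp only [Q, sub_re, re_ofReal_mul, e1]
    simp
  have key := norm_le_of_forall_boundary_reProdIm (F := fun w => f w * exp (Q w)) (K := A) hab hy
    (hf.mul (by fun_prop)) ?_ ?_ ?_ (z := z) ?_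
  · have hn : ‖f z‖ ≤ A * Real.exp (-(Q z).re) := by
      rw [norm_mul, Complex.norm_exp] at key
      rw [Real.exp_neg, ← div_eq_mul_inv, le_div_iff₀ (Real.exp_pos _)]
      exact key
    refine hn.trans ?_
    rw [hQre, mul_assoc]
    have hMb : M * (Real.cosh (al * (z.re - x)) * Real.cos (al * (z.im - y₀ / 2))) ≤
        8 * Real.exp (-(Real.pi * L / (4 * y₀))) := by
      have e1 : Real.cosh (al * (z.re - x)) ≤ Real.exp (al * (L / 3)) := by
        calc Real.cosh (al * (z.re - x)) ≤ Real.cosh (al * (L / 3)) := by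
              rw [Real.cosh_le_cosh, abs_mul, abs_mul, abs_of_pos hal0,
                abs_of_pos (by positivity : 0 < L / 3)]
              gcongr
          _ ≤ _ := by
              rw [Real.cosh_eq]
              have : Real.exp (-(al * (L / 3))) ≤ Real.exp (al * (L / 3)) :=
                Real.exp_le_exp.2 (by linarith [mul_pos hal0 hL])
              linarith
      have e2 : Real.exp (al * L) / 2 ≤ Real.cosh (al * L) := by
        rw [Real.cosh_eq]; linarith [Real.exp_pos (-(al * L))]
      have e3 : M ≤ 8 * E * Real.exp (-(al * L)) := by
        rw [hM, div_le_iff₀ hcosh]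
        have : Real.exp (-(al * L)) * Real.exp (al * L) = 1 := by rw [← Real.exp_add]; simp
        calc 4 * E = 8 * E * (Real.exp (-(al * L)) * (Real.exp (al * L) / 2)) := by
              linear_combination (-4 * E) * this
          _ ≤ 8 * E * (Real.exp (-(al * L)) * Real.cosh (al * L)) := by gcongr
          _ = _ := by ring
      calc M * (Real.cosh (al * (z.re - x)) * Real.cos (al * (z.im - y₀ / 2)))
          ≤ (8 * E * Real.exp (-(al * L))) * (Real.exp (al * (L / 3)) * 1) := by
            have := hcos z.im hz
            gcongr
            exact Real.cos_le_one _
        -- Here `(2/3)αL = πL/(2y₀)`, so the exponent is exactly `-πL/(4y₀)`; this fixes the width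
        -- `L/3`.
        _ = 8 * Real.exp (Real.pi * L / (4 * y₀) + -(al * L) + al * (L / 3)) := by
            rw [hE, Real.exp_add, Real.exp_add]; ring
        _ = _ := by
            congr 2; rw [hal]; field_simp; ring
    have hq1 : Real.exp (-(Real.pi * L / (4 * y₀))) ≤ 1 := Real.exp_le_one_iff.2 (by
      have : 0 < Real.pi * L / (4 * y₀) := by positivity
      linarith)
    have hb := exp_mul_le_one_add (K := 8) (Real.exp_pos _).le hq1
    have := (Real.exp_le_exp.2 hMb).trans hb
    calc A * Real.exp (-(-(lam * z.im) - M * (Real.cosh (al * (z.re - x)) *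
          Real.cos (al * (z.im - y₀ / 2)))))
        = A * (Real.exp (M * (Real.cosh (al * (z.re - x)) *
          Real.cos (al * (z.im - y₀ / 2)))) * Real.exp (lam * z.im)) := by
          rw [← Real.exp_add]; congr 2; ring
      _ ≤ _ := by gcongr
  · intro w hwre hwim
    rw [norm_mul, Complex.norm_exp, hQre]
    have hc := hcos w.im ⟨hwim.ge, hwim.le.trans hy.le⟩
    have : 0 ≤ M * (Real.cosh (al * (w.re - x)) * Real.cos (al * (w.im - y₀ / 2))) :=
      mul_nonneg hM0.le (mul_nonneg (Real.cosh_pos _).le (by linarith))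
    refine (mul_le_of_le_one_right (norm_nonneg _) (Real.exp_le_one_iff.2 ?_)).trans (h0 w hwre hwim)
    rw [hwim] at this ⊢
    linarith
  · intro w hwre hwim
    rw [norm_mul, Complex.norm_exp, hQre]
    have hc := hcos w.im ⟨hy.le.trans hwim.ge, hwim.le⟩
    have : 0 ≤ M * (Real.cosh (al * (w.re - x)) * Real.cos (al * (w.im - y₀ / 2))) :=
      mul_nonneg hM0.le (mul_nonneg (Real.cosh_pos _).le (by linarith))
    calc ‖f w‖ * _ ≤ A * Real.exp (lam * y₀) * Real.exp (-(lam * y₀)) := by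
          gcongr
          · exact h1 w hwre hwim
          · rw [hwim] at this ⊢; linarith
      _ = A := by rw [mul_assoc, ← Real.exp_add]; simp
  · intro w hwre hwim
    rw [norm_mul, Complex.norm_exp, hQre]
    have hc := hcos w.im hwim
    have hco : Real.cosh (al * L) ≤ Real.cosh (al * (w.re - x)) := by
      rw [Real.cosh_le_cosh, abs_mul, abs_mul]
      refine mul_le_mul_of_nonneg_left ?_ (abs_nonneg _)
      rw [abs_of_pos hL, le_abs]
      rcases hwre with h | h <;> rw [h]
      · right; linarith
      · left; linarith
    have : E ≤ M * (Real.cosh (al * (w.re - x)) * Real.cos (al * (w.im - y₀ / 2))) := by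
      calc E = M * (Real.cosh (al * L) * (1 / 4)) := by rw [hM]; field_simp
        _ ≤ _ := by gcongr
    calc ‖f w‖ * _ ≤ A * Real.exp (lam * w.im + E) * Real.exp (-(lam * w.im + E)) := by
          gcongr
          · exact h2 w hwre hwim
          · linarith
      _ = A := by rw [mul_assoc, ← Real.exp_add]; simp
  · have := abs_le.1 hzx
    exact ⟨⟨by linarith, by linarith⟩, hz⟩

end LocalBernstein

/-! ### The imaginary part of arccos and its maximum principle -/

namespace LocalBernstein

open Complex Set

theorem re_cos (z : ℂ) : (cos z).re = Real.cos z.re * Real.cosh z.im := by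
  rw [Complex.cos_eq z]
  simp [← ofReal_cosh, ← ofReal_cos, ← ofReal_sinh, ← ofReal_sin]

theorem im_cos (z : ℂ) : (cos z).im = -(Real.sin z.re * Real.sinh z.im) := by
  rw [Complex.cos_eq z]
  simp [← ofReal_cosh, ← ofReal_cos, ← ofReal_sinh, ← ofReal_sin]

theorem sq_norm_cos (z : ℂ) : ‖cos z‖ ^ 2 = Real.cos z.re ^ 2 + Real.sinh z.im ^ 2 := by
  rw [← normSq_eq_norm_sq, normSq_apply, re_cos, im_cos]
  have h1 := Real.cosh_sq z.im
  have h2 := Real.sin_sq_add_cos_sq z.re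
  linear_combination (Real.cos z.re) ^ 2 * h1 + (Real.sinh z.im) ^ 2 * h2

theorem norm_cos_le (z : ℂ) : ‖cos z‖ ≤ Real.cosh z.im := by
  refine le_of_sq_le_sq ?_ (Real.cosh_pos _).le
  rw [sq_norm_cos, Real.cosh_sq]
  linarith [Real.cos_sq_le_one z.re]

theorem sinh_abs_im_le_norm_cos (z : ℂ) : Real.sinh |z.im| ≤ ‖cos z‖ := by
  refine le_of_sq_le_sq ?_ (norm_nonneg _)
  rw [sq_norm_cos, ← Real.abs_sinh, sq_abs]
  linarith [sq_nonneg (Real.cos z.re)]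

/-- From `e^{|im z|} ≤ 2e^u + 1 ≤ 3e^u ≤ e^{u+2}`. -/
theorem abs_im_le_add_two {z : ℂ} {u : ℝ} (hu : 0 ≤ u) (h : Real.sinh |z.im| ≤ Real.exp u) :
    |z.im| ≤ u + 2 := by
  rw [← Real.exp_le_exp, Real.exp_add]
  rw [Real.sinh_eq] at h
  have h1 : Real.exp (-|z.im|) ≤ 1 := Real.exp_le_one_iff.2 (by simp)
  have h2 : 1 ≤ Real.exp u := Real.one_le_exp hu
  have h3 : (3 : ℝ) ≤ Real.exp 2 := by linarith [Real.add_one_le_exp (2 : ℝ)]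
  nlinarith

theorem im_eq_zero_of_cos_real {z : ℂ} (h : (cos z).im = 0) (h1 : ‖cos z‖ ≤ 1) : z.im = 0 := by
  by_contra h0
  have hs : 0 < Real.sinh z.im ^ 2 := by
    have : Real.sinh z.im ≠ 0 := by simpa using h0
    positivity
  have h2 : Real.sin z.re = 0 := by
    rw [im_cos] at h
    rcases mul_eq_zero.1 (neg_eq_zero.1 h) with h | h
    · exact h
    · rw [h] at hs; simp at hs
  have h3 := sq_norm_cos z
  have h4 := Real.sin_sq_add_cos_sq z.re
  rw [h2] at h4
  nlinarith [norm_nonneg (cos z)]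

open Polynomial.Chebyshev in
/-- If `w = cos ζ`, then `|im ζ|` is a subharmonic function of `w`; hence it obeys the maximum
principle against real parts of holomorphic functions. -/
theorem abs_im_le_re_of_boundary {w P : ℂ → ℂ} {a b h : ℝ} (hab : a < b) (hh : 0 < h)
    (hw : DifferentiableOn ℂ w (Icc a b ×ℂ Icc 0 h))
    (hP : DifferentiableOn ℂ P (Icc a b ×ℂ Icc 0 h))
    (h0 : ∀ z : ℂ, z.re ∈ Icc a b → z.im = 0 → ∀ ζ, cos ζ = w z → |ζ.im| ≤ (P z).re)
    (h1 : ∀ z : ℂ, z.re ∈ Icc a b → z.im = h → ∀ ζ, cos ζ = w z → |ζ.im| ≤ (P z).re)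
    (h2 : ∀ z : ℂ, z.re = a ∨ z.re = b → z.im ∈ Icc 0 h → ∀ ζ, cos ζ = w z → |ζ.im| ≤ (P z).re)
    {z : ℂ} (hz : z ∈ Icc a b ×ℂ Icc 0 h) (hPz : 0 ≤ (P z).re) {ζ : ℂ} (hζ : cos ζ = w z) :
    |ζ.im| ≤ (P z).re := by
  -- Although `ζ` has no global holomorphic choice, `cos (nζ) = T_n(w)` is holomorphic and has size
  -- about `e^{n |im ζ|}`.
  have key : ∀ n : ℕ, ‖(T ℂ n).eval (w z) * exp (-(n * P z))‖ ≤ 1 := by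
    intro n
    have bd : ∀ v : ℂ, (∀ ζ, cos ζ = w v → |ζ.im| ≤ (P v).re) →
        ‖(T ℂ n).eval (w v) * exp (-(n * P v))‖ ≤ 1 := by
      intro v hv
      obtain ⟨η, hη⟩ := cos_surjective (w v)
      have := hv η hη
      rw [← hη, T_complex_cos, norm_mul, Complex.norm_exp]
      have e1 : (-((n : ℂ) * P v)).re = -(n * (P v).re) := by simp
      have e2 : ((n : ℤ) * η : ℂ).im = n * η.im := by simp
      rw [e1, Real.exp_neg, ← div_eq_mul_inv, div_le_one (Real.exp_pos _)]
      calc ‖cos ((n : ℤ) * η)‖ ≤ Real.cosh (n * |η.im|) := by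
            refine (norm_cos_le _).trans_eq ?_
            rw [e2, ← Real.cosh_abs, abs_mul, Nat.abs_cast]
        _ ≤ Real.exp (n * |η.im|) := by
            rw [Real.cosh_eq]
            have : Real.exp (-(n * |η.im|)) ≤ Real.exp (n * |η.im|) := by
              rw [Real.exp_le_exp]
              have : 0 ≤ n * |η.im| := by positivity
              linarith
            linarith
        _ ≤ _ := by gcongr
    refine norm_le_of_forall_boundary_reProdIm
      (F := fun v => (T ℂ n).eval (w v) * exp (-(n * P v))) hab hh ?_
      (fun v hv hv' => bd v (h0 v hv hv')) (fun v hv hv' => bd v (h1 v hv hv'))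
      (fun v hv hv' => bd v (h2 v hv hv')) hz
    refine DifferentiableOn.mul ?_ ?_
    · exact (T ℂ n).differentiable.comp_differentiableOn hw
    · exact ((hP.const_mul _).neg).cexp
  -- The additive loss does not depend on `n`, so it disappears on dividing by a large `n`.
  have key2 : ∀ n : ℕ, n * |ζ.im| ≤ n * (P z).re + 2 := by
    intro n
    have hn := key n
    rw [← hζ, T_complex_cos, norm_mul, Complex.norm_exp] at hn
    have e1 : (-((n : ℂ) * P z)).re = -(n * (P z).re) := by simp
    have e2 : |((n : ℤ) * ζ : ℂ).im| = n * |ζ.im| := by simp [abs_mul]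
    rw [e1, Real.exp_neg, ← div_eq_mul_inv, div_le_one (Real.exp_pos _)] at hn
    rw [← e2]
    exact abs_im_le_add_two (by positivity) ((sinh_abs_im_le_norm_cos _).trans hn)
  by_contra hlt
  rw [not_le] at hlt
  obtain ⟨n, hn⟩ := exists_nat_gt (2 / (|ζ.im| - (P z).re))
  rw [div_lt_iff₀ (by linarith)] at hn
  linarith [key2 n]

/-- Replaces the crude bound `λy + 2` by one vanishing linearly at the real axis, which
differentiation there requires. -/
theorem abs_im_le_of_norm_le_exp {w : ℂ → ℂ} {x l y₀ lam : ℝ} (hl : 0 < l) (hy : 0 < y₀)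
    (hlam : 0 < lam)
    (hw : DifferentiableOn ℂ w (Icc (x - l) (x + l) ×ℂ Icc 0 y₀))
    (hr : ∀ z : ℂ, z.re ∈ Icc (x - l) (x + l) → z.im = 0 → (w z).im = 0 ∧ ‖w z‖ ≤ 1)
    (hb : ∀ z : ℂ, z ∈ Icc (x - l) (x + l) ×ℂ Icc 0 y₀ → ‖w z‖ ≤ Real.exp (lam * z.im))
    {y : ℝ} (hyy : y ∈ Icc 0 y₀) {ζ : ℂ} (hζ : cos ζ = w (x + y * I)) :
    |ζ.im| ≤ (lam + 4 / min y₀ l) * y := by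
  have gen : ∀ z : ℂ, z ∈ Icc (x - l) (x + l) ×ℂ Icc 0 y₀ → ∀ η, cos η = w z →
      |η.im| ≤ lam * z.im + 2 := by
    intro z hz η hη
    refine abs_im_le_add_two (mul_nonneg hlam.le hz.2.1)
      ((sinh_abs_im_le_norm_cos _).trans ?_)
    rw [hη]
    exact hb z hz
  set h := min y₀ l with hh
  have hh0 : 0 < h := lt_min hy hl
  have hhy : h ≤ y₀ := min_le_left _ _
  have hhl : h ≤ l := min_le_right _ _
  have hmem : ∀ {s : ℝ}, s ∈ Icc 0 y₀ → (x + s * I : ℂ) ∈ Icc (x - l) (x + l) ×ℂ Icc 0 y₀ := by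
    intro s hs
    rw [mem_reProdIm]
    constructor
    · simp [hl.le]
    · simpa using hs
  -- Above height `h` the crude bound already suffices.
  rcases lt_or_ge h y with hlt | hle
  · have h1 := gen _ (hmem hyy) ζ hζ
    have h2 : 2 ≤ 4 / h * y := by
      rw [div_mul_eq_mul_div, le_div_iff₀ hh0]
      linarith
    simp only [add_im, ofReal_im, mul_im, ofReal_re, I_im, mul_one, I_re, mul_zero, zero_add,
      add_zero] at h1
    linarith
  -- The second term of the majorant supplies the slack `2` on the top edge, the third on the sides.
  -- Each costs at most `2y/h` on the central line, whence the `4`.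
  · let P : ℂ → ℂ := fun z => -(I * lam) * (z - x) + (2 / h : ℝ) * (-I * (z - x)) +
      (2 / l ^ 2 : ℝ) * ((z - x) ^ 2 - I * h * (z - x))
    have hPre : ∀ z, (P z).re = lam * z.im + 2 / h * z.im +
        2 / l ^ 2 * ((z.re - x) ^ 2 + z.im * (h - z.im)) := by
      intro z
      simp only [P, add_re, re_ofReal_mul]
      simp [pow_two]
      left
      ring
    have hsub : Icc (x - l) (x + l) ×ℂ Icc 0 h ⊆ Icc (x - l) (x + l) ×ℂ Icc 0 y₀ :=
      fun z hz => ⟨hz.1, hz.2.1, hz.2.2.trans hhy⟩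
    have pos : ∀ z : ℂ, z.im ∈ Icc 0 h →
        0 ≤ lam * z.im ∧ 0 ≤ 2 / h * z.im ∧ 0 ≤ z.im * (h - z.im) := fun z hz =>
      ⟨mul_nonneg hlam.le hz.1, mul_nonneg (by positivity) hz.1,
        mul_nonneg hz.1 (sub_nonneg.2 hz.2)⟩
    have pos2 : ∀ z : ℂ, z.im ∈ Icc 0 h →
        0 ≤ 2 / l ^ 2 * ((z.re - x) ^ 2 + z.im * (h - z.im)) := fun z hz =>
      mul_nonneg (by positivity) (add_nonneg (sq_nonneg _) (pos z hz).2.2)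
    have hyh : (x + y * I : ℂ).im ∈ Icc 0 h := by simpa using ⟨hyy.1, hle⟩
    have main := abs_im_le_re_of_boundary (P := P) (z := x + y * I) (by linarith) hh0
      (hw.mono hsub) (by fun_prop) ?_ ?_ ?_ ⟨(hmem hyy).1, hyh⟩ ?_ hζ
    · rw [hPre] at main
      simp only [add_im, ofReal_im, mul_im, ofReal_re, I_im, mul_one, I_re, mul_zero, zero_add,
        add_zero, add_re, mul_re, sub_self] at main
      have h3 : 2 / l ^ 2 * (0 ^ 2 + y * (h - y)) ≤ 2 / h * y := by
        calc 2 / l ^ 2 * (0 ^ 2 + y * (h - y)) ≤ 2 / l ^ 2 * (y * h) := by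
              gcongr; nlinarith [hyy.1]
          _ ≤ 2 / h ^ 2 * (y * h) := by
              have := hyy.1
              gcongr
          _ = 2 / h * y := by field_simp
      calc |ζ.im| ≤ _ := main
        _ ≤ lam * y + 2 / h * y + 2 / h * y := by linarith
        _ = _ := by ring
    · intro z hz hz' η hη
      have := hr z hz hz'
      rw [← hη] at this
      rw [im_eq_zero_of_cos_real this.1 this.2, hPre]
      have hz'' : z.im ∈ Icc 0 h := ⟨hz'.ge, hz'.le.trans hh0.le⟩
      have h1 := pos z hz''
      have h2 := pos2 z hz''
      rw [abs_zero]
      linarith [h1.1, h1.2.1]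
    · intro z hz hz' η hη
      have hz'' : z.im ∈ Icc 0 h := ⟨hh0.le.trans hz'.ge, hz'.le⟩
      have h1 := gen z (hsub ⟨hz, hz''⟩) η hη
      have h2 := pos2 z hz''
      have h3 : 2 / h * z.im = 2 := by rw [hz']; field_simp
      rw [hPre]
      linarith
    · intro z hz hz'' η hη
      have hzl : z.re ∈ Icc (x - l) (x + l) := by
        rcases hz with h | h <;> rw [h] <;> constructor <;> linarith
      have h1 := gen z (hsub ⟨hzl, hz''⟩) η hη
      have h2 := pos z hz''
      have h3 : (z.re - x) ^ 2 = l ^ 2 := by rcases hz with h | h <;> rw [h] <;> ring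
      have h4 : 2 ≤ 2 / l ^ 2 * ((z.re - x) ^ 2 + z.im * (h - z.im)) := by
        rw [h3, div_mul_eq_mul_div, le_div_iff₀ (by positivity)]
        linarith [h2.2.2]
      rw [hPre]
      linarith [h2.2.1]
    · rw [hPre]
      have h1 := pos _ hyh
      have h2 := pos2 _ hyh
      linarith [h1.1, h1.2.1]

end LocalBernstein

/-! ### The first-order inequality on the real axis -/

namespace LocalBernstein

open Complex Set Filter Topology

/-- Cosine maps the strip into the ellipse with semi-axes `cosh τ` and `sinh τ`. Denominators are
cleared to include `τ = 0`. -/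
theorem cos_mem_ellipse {ζ : ℂ} {τ : ℝ} (h : |ζ.im| ≤ τ) :
    (cos ζ).re ^ 2 * Real.sinh τ ^ 2 + (cos ζ).im ^ 2 * Real.cosh τ ^ 2 ≤
      Real.sinh τ ^ 2 * Real.cosh τ ^ 2 := by
  have h0 : 0 ≤ τ := (abs_nonneg _).trans h
  have hc : Real.cosh ζ.im ≤ Real.cosh τ := by
    rwa [Real.cosh_le_cosh, abs_of_nonneg h0]
  have hs : Real.sinh ζ.im ^ 2 ≤ Real.sinh τ ^ 2 := by
    rw [← sq_abs (Real.sinh ζ.im), Real.abs_sinh]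
    have : 0 ≤ Real.sinh |ζ.im| := Real.sinh_nonneg_iff.2 (abs_nonneg _)
    gcongr
    exact Real.sinh_le_sinh.2 h
  rw [re_cos, im_cos]
  calc _ = Real.cos ζ.re ^ 2 * Real.cosh ζ.im ^ 2 * Real.sinh τ ^ 2 +
        Real.sin ζ.re ^ 2 * Real.sinh ζ.im ^ 2 * Real.cosh τ ^ 2 := by ring
    _ ≤ Real.cos ζ.re ^ 2 * Real.cosh τ ^ 2 * Real.sinh τ ^ 2 +
        Real.sin ζ.re ^ 2 * Real.sinh τ ^ 2 * Real.cosh τ ^ 2 := by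
        have := (Real.cosh_pos ζ.im).le
        gcongr
    _ = (Real.sin ζ.re ^ 2 + Real.cos ζ.re ^ 2) * (Real.sinh τ ^ 2 * Real.cosh τ ^ 2) := by ring
    _ = _ := by rw [Real.sin_sq_add_cos_sq, one_mul]

/-- Infinitesimal form of the bound `|im arccos w| ≤ Λ y` on a vertical segment. -/
theorem sq_add_sq_le_of_abs_im_le {w : ℂ → ℂ} {S : Set ℂ} {x y₀ Lam : ℝ} {d : ℂ} (hy : 0 < y₀)
    (hS : ∀ y ∈ Icc 0 y₀, (x + y * I : ℂ) ∈ S) (hd : HasDerivWithinAt w d S x)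
    (hw0 : (w x).im = 0)
    (h : ∀ y ∈ Icc 0 y₀, ∀ ζ, cos ζ = w (x + y * I) → |ζ.im| ≤ Lam * y) :
    (w x).re ^ 2 * Lam ^ 2 + d.re ^ 2 ≤ Lam ^ 2 := by
  have hcurve : HasDerivWithinAt (fun y : ℝ => w (x + y * I)) (I * d) (Icc 0 y₀) 0 := by
    have h1 : HasDerivWithinAt (fun y : ℝ => (x + y * I : ℂ)) I (Icc 0 y₀) 0 := by
      have := ((ofRealCLM.hasDerivAt (x := 0)).mul_const I).const_add (x : ℂ)
      simpa using this.hasDerivWithinAt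
    have h2 : HasDerivWithinAt w d S ((fun y : ℝ => (x + y * I : ℂ)) 0) := by simpa using hd
    simpa [Function.comp_def] using HasDerivWithinAt.scomp (0 : ℝ) h2 h1 hS
  have hcurve' := hcurve.mono Ioc_subset_Icc_self
  have him : HasDerivWithinAt (fun y : ℝ => (w (x + y * I)).im) d.re (Ioc 0 y₀) 0 := by
    simpa [Function.comp_def] using imCLM.hasFDerivAt.comp_hasDerivWithinAt (0 : ℝ) hcurve'
  have hre : Tendsto (fun y : ℝ => (w (x + y * I)).re) (𝓝[Ioc 0 y₀] 0) (𝓝 (w x).re) := by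
    have := (continuous_re.continuousAt.comp_continuousWithinAt hcurve'.continuousWithinAt).tendsto
    simpa [Function.comp_def] using this
  have hsl : Tendsto (fun y : ℝ => (w (x + y * I)).im / y) (𝓝[Ioc 0 y₀] 0) (𝓝 d.re) := by
    rw [hasDerivWithinAt_iff_tendsto_slope' (by simp)] at him
    refine him.congr fun y => ?_
    simp [slope_def_field, hw0]
  have hsinh : Tendsto (fun y : ℝ => Real.sinh (Lam * y) / y) (𝓝[Ioc 0 y₀] 0) (𝓝 Lam) := by
    have h1 : HasDerivAt (fun y : ℝ => Real.sinh (Lam * y)) Lam 0 := by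
      simpa using ((hasDerivAt_id (0 : ℝ)).const_mul Lam).sinh
    have h2 := h1.hasDerivWithinAt (s := Ioc 0 y₀)
    rw [hasDerivWithinAt_iff_tendsto_slope' (by simp)] at h2
    refine h2.congr fun y => ?_
    simp [slope_def_field]
  have hcosh : Tendsto (fun y : ℝ => Real.cosh (Lam * y)) (𝓝[Ioc 0 y₀] 0) (𝓝 1) := by
    have : Continuous fun y : ℝ => Real.cosh (Lam * y) := by fun_prop
    simpa using (this.tendsto 0).mono_left nhdsWithin_le_nhds
  have hne : (𝓝[Ioc 0 y₀] (0 : ℝ)).NeBot := by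
    rw [nhdsWithin_Ioc_eq_nhdsGT hy]; infer_instance
  -- The ellipse inequality with `τ = Λy`, divided by `y²`, passes to the limit `y → 0+`.
  have hlim := le_of_tendsto_of_tendsto
    (((hre.pow 2).mul (hsinh.pow 2)).add ((hsl.pow 2).mul (hcosh.pow 2)))
    ((hsinh.pow 2).mul (hcosh.pow 2)) ?_
  · simpa using hlim
  · filter_upwards [self_mem_nhdsWithin] with y hyy
    obtain ⟨ζ, hζ⟩ := cos_surjective (w (x + y * I))
    have := cos_mem_ellipse (h y (Ioc_subset_Icc_self hyy) ζ hζ)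
    rw [hζ] at this
    have hy2 : 0 < y := hyy.1
    have e : ∀ p q r s : ℝ, p * (q / y) ^ 2 + (r / y) ^ 2 * s = (p * q ^ 2 + r ^ 2 * s) / y ^ 2 := by
      intro p q r s; field_simp
    rw [e, div_pow, div_mul_eq_mul_div]
    gcongr

/-- The derivative can be computed along the real segment, where `f` is real. -/
theorem im_eq_zero_of_hasDerivWithinAt {f : ℂ → ℂ} {S : Set ℂ} {a b x : ℝ} {d : ℂ}
    (hx : x ∈ Ioo a b) (hS : ∀ s ∈ Icc a b, (s : ℂ) ∈ S) (hd : HasDerivWithinAt f d S x)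
    (hf : ∀ s ∈ Icc a b, (f s).im = 0) : d.im = 0 := by
  have h1 : HasDerivWithinAt (fun s : ℝ => (s : ℂ)) 1 (Icc a b) x := by
    simpa using (hasDerivAt_id' x).ofReal_comp.hasDerivWithinAt
  have h2 : HasDerivWithinAt (fun s : ℝ => f s) d (Icc a b) x := by
    simpa [Function.comp_def] using HasDerivWithinAt.scomp x hd h1 hS
  have h3 : HasDerivWithinAt (fun s : ℝ => (f s).im) d.im (Icc a b) x := by
    simpa [Function.comp_def] using imCLM.hasFDerivAt.comp_hasDerivWithinAt x h2
  have h4 : HasDerivWithinAt (fun s : ℝ => (f s).im) 0 (Icc a b) x :=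
    (hasDerivWithinAt_const x _ (0 : ℝ)).congr hf (hf x (Ioo_subset_Icc_self hx))
  exact (uniqueDiffOn_Icc (hx.1.trans hx.2) x (Ioo_subset_Icc_self hx)).eq_deriv _ h3 h4

end LocalBernstein

/-! ### Schwarz reflection and Jensen's zero count -/

namespace LocalBernstein

open Complex Set Filter Topology Metric
open scoped ComplexConjugate

/-- Schwarz reflection. -/
theorem analyticOnNhd_reflectExt {f : ℂ → ℂ} {S : Set ℂ} {x ρ : ℝ}
    (hf : DifferentiableOn ℂ f S) (hS : ∀ z ∈ ball (x : ℂ) ρ, 0 ≤ z.im → z ∈ S)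
    (hr : ∀ z ∈ ball (x : ℂ) ρ, z.im = 0 → (f z).im = 0) :
    AnalyticOnNhd ℂ (reflectExt f) (ball (x : ℂ) ρ) := by
  have hconj : ∀ z ∈ ball (x : ℂ) ρ, conj z ∈ ball (x : ℂ) ρ := by
    intro z hz
    rwa [mem_ball, ← dist_conj_conj, conj_conj, conj_ofReal]
  refine DifferentiableOn.analyticOnNhd (fun z hz => ?_) isOpen_ball
  refine DifferentiableAt.differentiableWithinAt ?_
  have hup : ∀ z ∈ ball (x : ℂ) ρ, 0 < z.im → DifferentiableAt ℂ f z := by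
    intro z hz hzi
    refine hf.differentiableAt ?_
    filter_upwards [isOpen_ball.mem_nhds hz, (isOpen_lt continuous_const continuous_im).mem_nhds hzi]
      with w h1 h2 using hS w h1 (le_of_lt h2)
  rcases lt_trichotomy z.im 0 with h | h | h
  · have h1 := (hup _ (hconj z hz) (by simpa using h)).conj_conj
    rw [conj_conj] at h1
    refine h1.congr_of_eventuallyEq ?_
    filter_upwards [(isOpen_lt continuous_im continuous_const).mem_nhds h] with w hw
    simp [reflectExt, not_le.2 (show w.im < 0 from hw)]
  · have hzS : z ∈ S := hS z hz h.ge
    have hzc : conj z = z := conj_eq_iff_im.2 h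
    have h1 := (hf z hzS).hasDerivWithinAt
    set d := derivWithin f S z
    have hval : ∀ w ∈ ball (x : ℂ) ρ, w.im ≤ 0 → reflectExt f w = conj (f (conj w)) := by
      intro w hw hwi
      rcases hwi.lt_or_eq with h | h
      · simp [reflectExt, not_le.2 h]
      · rw [reflectExt, if_pos h.ge, conj_eq_iff_im.2 h, conj_eq_iff_im.2 (hr w hw h)]
    have hU : HasDerivWithinAt (reflectExt f) d (ball (x : ℂ) ρ ∩ {w | 0 ≤ w.im}) z := by
      refine (h1.mono fun w hw => hS w hw.1 hw.2).congr (fun w hw => ?_) ?_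
      · simp [reflectExt, show 0 ≤ w.im from hw.2]
      · simp [reflectExt, h]
    -- Difference quotients from below are conjugates of those from above, so they tend to `conj d`,
    -- which equals `d` because `d` is real.
    have hD : HasDerivWithinAt (reflectExt f) d (ball (x : ℂ) ρ ∩ {w | w.im ≤ 0}) z := by
      have hd : conj d = d := by
        have hzx : (z.re : ℂ) = z := conj_eq_iff_re.1 hzc
        have hz' := hz
        rw [mem_ball, ← hzx, Complex.dist_eq, ← ofReal_sub, norm_real, Real.norm_eq_abs,
          abs_lt] at hz'
        obtain ⟨p, hp1, hp2⟩ := exists_between hz'.1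
        obtain ⟨q, hq1, hq2⟩ := exists_between hz'.2
        have hin : ∀ s ∈ Icc (x + p) (x + q), (s : ℂ) ∈ ball (x : ℂ) ρ := by
          intro s hs
          rw [mem_ball, Complex.dist_eq, ← ofReal_sub, norm_real, Real.norm_eq_abs, abs_lt]
          constructor <;> linarith [hs.1, hs.2]
        refine conj_eq_iff_im.2 (im_eq_zero_of_hasDerivWithinAt (f := f) (S := S) (x := z.re)
          (a := x + p) (b := x + q) ⟨by linarith, by linarith⟩
          (fun s hs => hS s (hin s hs) (by simp)) (hzx.symm ▸ h1)
          fun s hs => hr s (hin s hs) (by simp))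
      rw [hasDerivWithinAt_iff_tendsto_slope, ← hd]
      have hmap : Tendsto (conj : ℂ → ℂ) (𝓝[(ball (x : ℂ) ρ ∩ {w | w.im ≤ 0}) \ {z}] z)
          (𝓝[S \ {z}] z) := by
        refine tendsto_nhdsWithin_iff.2 ⟨?_, ?_⟩
        · have := (continuous_conj.tendsto z).mono_left
            (nhdsWithin_le_nhds (s := (ball (x : ℂ) ρ ∩ {w | w.im ≤ 0}) \ {z}))
          rwa [hzc] at this
        · filter_upwards [self_mem_nhdsWithin] with w hw
          refine ⟨hS _ (hconj w hw.1.1) (by simpa using hw.1.2), fun hwz => hw.2 ?_⟩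
          rw [mem_singleton_iff] at hwz ⊢
          rw [← conj_conj w, hwz, hzc]
      have hlim := (continuous_conj.tendsto d).comp
        ((hasDerivWithinAt_iff_tendsto_slope.1 h1).comp hmap)
      refine hlim.congr' ?_
      filter_upwards [self_mem_nhdsWithin] with w hw
      simp only [Function.comp_apply, slope_def_field, map_div₀, map_sub, conj_conj, hzc]
      rw [hval w hw.1.1 hw.1.2, hval z hz h.le, hzc]
    have := hU.union hD
    refine (this.hasDerivAt ?_).differentiableAt
    filter_upwards [isOpen_ball.mem_nhds hz] with w hw
    rcases le_total 0 w.im with h | h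
    · exact Or.inl ⟨hw, h⟩
    · exact Or.inr ⟨hw, h⟩
  · refine (hup z hz h).congr_of_eventuallyEq ?_
    filter_upwards [(isOpen_lt continuous_const continuous_im).mem_nhds h] with w hw
    simp [reflectExt, le_of_lt (show 0 < w.im from hw)]

/-- Jensen's bound for the number of zeroes in a disk. -/
theorem zeroCount_ball_le {g : ℂ → ℂ} {c : ℂ} {r R M : ℝ} (hr : 0 < r) (hrR : r < R) (hM : 0 < M)
    (hg : AnalyticOnNhd ℂ g (closedBall c R)) (hc : g c ≠ 0)
    (hb : ∀ z ∈ sphere c R, ‖g z‖ ≤ M) :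
    {z ∈ ball c r | g z = 0}.Finite ∧
      (zeroCount g (ball c r) : ℝ) ≤ Real.log (M / ‖g c‖) / Real.log (R / r) := by
  have hR : 0 < R := hr.trans hrR
  set g₁ : ℂ → ℂ := fun z => (M : ℂ)⁻¹ * g z with hg₁
  have hM' : (M : ℂ)⁻¹ ≠ 0 := by simpa using hM.ne'
  have hg1 : AnalyticOnNhd ℂ g₁ (closedBall c R) := fun z hz => analyticAt_const.mul (hg z hz)
  have hJ := AnalyticOnNhd.sum_divisor_le (f := g₁) (c := c) (r := r) (R := R) (M := 1)
    (by simpa using hr.ne') (by rwa [abs_of_pos hr, abs_of_pos hR]) le_rfl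
    (by rwa [abs_of_pos hR]) (mul_ne_zero hM' hc) (by
      intro z hz
      rw [abs_of_pos hR] at hz
      rw [norm_mul, norm_inv, norm_real, Real.norm_of_nonneg hM.le, inv_mul_le_iff₀ hM, mul_one]
      exact hb z hz)
  rw [abs_of_pos hr] at hJ
  set D := MeromorphicOn.divisor g₁ (closedBall c r) with hD
  have hsub : closedBall c r ⊆ closedBall c R := closedBall_subset_closedBall hrR.le
  -- By the identity theorem no order is infinite, so the natural-number orders lose nothing.
  have hfin : ∀ z ∈ closedBall c R, analyticOrderAt g z ≠ ⊤ := by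
    intro z hz
    have hcm : c ∈ closedBall c R := mem_closedBall_self hR.le
    refine hg.analyticOrderAt_ne_top_of_isPreconnected
      (convex_closedBall c R).isPreconnected hcm hz ?_
    rw [(hg c hcm).analyticOrderAt_eq_zero.2 hc]
    simp
  have hDval : ∀ z ∈ closedBall c r, D z = (analyticOrderNatAt g z : ℤ) := by
    intro z hz
    have e : analyticOrderAt g₁ z = analyticOrderAt g z := by
      have := analyticOrderAt_mul (f := fun _ => (M : ℂ)⁻¹) (g := g) (z₀ := z) analyticAt_const
        (hg z (hsub hz))
      rw [analyticAt_const.analyticOrderAt_eq_zero.2 hM', zero_add] at this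
      exact this
    rw [hD, MeromorphicOn.AnalyticOnNhd.divisor_apply (hg1.mono hsub) hz, e,
      ← Nat.cast_analyticOrderNatAt (hfin z (hsub hz))]
    rfl
  have hDfin : (Function.support D).Finite := D.finiteSupport (isCompact_closedBall c r)
  have hsupp : ∀ z ∈ ball c r, analyticOrderNatAt g z ≠ 0 → z ∈ Function.support D := by
    intro z hz h0
    rw [Function.mem_support, hDval z (ball_subset_closedBall hz)]
    exact_mod_cast h0
  constructor
  · refine hDfin.subset fun z hz => hsupp z hz.1 ?_
    have hzR := hsub (ball_subset_closedBall hz.1)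
    intro h0
    have h1 := Nat.cast_analyticOrderNatAt (hfin z hzR)
    rw [h0] at h1
    exact (hg z hzR).analyticOrderAt_eq_zero.1 (by simpa using h1.symm) hz.2
  · have hle : (zeroCount g (ball c r) : ℤ) ≤ ∑ᶠ z, D z := by
      have hD0 : ∀ z, 0 ≤ D z := fun z =>
        MeromorphicOn.AnalyticOnNhd.divisor_nonneg (hg1.mono hsub) z
      have e1 : zeroCount g (ball c r) = ∑ z ∈ hDfin.toFinset, (ball c r).indicator (analyticOrderNatAt g) z := by
        rw [zeroCount, finsum_mem_def]
        refine finsum_eq_sum_of_support_subset _ fun z hz => ?_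
        have hz1 : z ∈ ball c r := mem_of_indicator_ne_zero hz
        rw [Function.mem_support, indicator_of_mem hz1] at hz
        simpa using hsupp z hz1 hz
      rw [e1, finsum_eq_sum_of_support_subset D (s := hDfin.toFinset) (by simp), Nat.cast_sum]
      refine Finset.sum_le_sum fun z _ => ?_
      by_cases hz : z ∈ ball c r
      · rw [indicator_of_mem hz, hDval z (ball_subset_closedBall hz)]
      · rw [indicator_of_notMem hz]
        exact_mod_cast hD0 z
    have e : 1 / ‖g₁ c‖ = M / ‖g c‖ := by
      rw [hg₁]
      simp only [norm_mul, norm_inv, norm_real, Real.norm_of_nonneg hM.le]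
      field_simp
    rw [e] at hJ
    calc (zeroCount g (ball c r) : ℝ) = ((zeroCount g (ball c r) : ℤ) : ℝ) := by simp
      _ ≤ ((∑ᶠ z, D z : ℤ) : ℝ) := by exact_mod_cast hle
      _ ≤ _ := hJ

end LocalBernstein

/-! ### Rescaling and the individual conclusions -/

namespace LocalBernstein

open Complex Set Metric
open scoped ComplexConjugate

theorem abs_im_le_of_norm_le_mul_exp {f : ℂ → ℂ} {x l y₀ lam B : ℝ} (hl : 0 < l) (hy : 0 < y₀)
    (hlam : 0 < lam) (hB : 0 < B)
    (hf : DifferentiableOn ℂ f (Icc (x - l) (x + l) ×ℂ Icc 0 y₀))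
    (hr : ∀ z : ℂ, z.re ∈ Icc (x - l) (x + l) → z.im = 0 → (f z).im = 0 ∧ ‖f z‖ ≤ B)
    (hb : ∀ z : ℂ, z ∈ Icc (x - l) (x + l) ×ℂ Icc 0 y₀ → ‖f z‖ ≤ B * Real.exp (lam * z.im))
    {y : ℝ} (hyy : y ∈ Icc 0 y₀) {ζ : ℂ} (hζ : cos ζ = f (x + y * I) / B) :
    |ζ.im| ≤ (lam + 4 / min y₀ l) * y := by
  refine abs_im_le_of_norm_le_exp (w := fun z => f z / B) hl hy hlam (hf.div_const _) ?_ ?_ hyy hζ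
  · intro z hz hz'
    obtain ⟨h1, h2⟩ := hr z hz hz'
    rw [div_ofReal_im, h1, norm_div, norm_real, Real.norm_of_nonneg hB.le, zero_div, div_le_one hB]
    exact ⟨rfl, h2⟩
  · intro z hz
    rw [norm_div, norm_real, Real.norm_of_nonneg hB.le, div_le_iff₀ hB, mul_comm]
    exact hb z hz

theorem norm_le_mul_cosh {w : ℂ} {B τ : ℝ} (hB : 0 < B)
    (h : ∀ ζ, cos ζ = w / B → |ζ.im| ≤ τ) : ‖w‖ ≤ B * Real.cosh τ := by
  obtain ⟨ζ, hζ⟩ := cos_surjective (w / B)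
  have h1 := h ζ hζ
  have h2 : Real.cosh ζ.im ≤ Real.cosh τ :=
    Real.cosh_le_cosh.2 (h1.trans (le_abs_self τ))
  have h3 := (norm_cos_le ζ).trans h2
  rwa [hζ, norm_div, norm_real, Real.norm_of_nonneg hB.le, div_le_iff₀ hB, mul_comm] at h3

/-- For real `u` and `d`, `‖u + i d/λ‖² = u² + d²/λ²`, and `λ ≤ Λ` lets the ellipse inequality bound
it. -/
theorem norm_add_I_mul_div_le {u d : ℂ} {B lam Lam : ℝ} (hB : 0 < B) (hlam : 0 < lam)
    (hLam : lam ≤ Lam) (hu : u.im = 0) (hd : d.im = 0)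
    (h : (u / B).re ^ 2 * Lam ^ 2 + (d / B).re ^ 2 ≤ Lam ^ 2) :
    ‖d‖ ≤ B * Lam ∧ ‖u + I * d / lam‖ ≤ B * (Lam / lam) := by
  rw [div_ofReal_re, div_ofReal_re, div_pow, div_pow, div_mul_eq_mul_div, ← add_div,
    div_le_iff₀ (by positivity)] at h
  have hLam0 := hlam.trans_le hLam
  constructor
  · refine le_of_sq_le_sq ?_ (by positivity)
    rw [← normSq_eq_norm_sq, normSq_apply, hd]
    nlinarith [mul_nonneg (sq_nonneg u.re) (sq_nonneg Lam)]
  · refine le_of_sq_le_sq ?_ (by positivity)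
    rw [← normSq_eq_norm_sq, normSq_apply, add_re, add_im, div_ofReal_re, div_ofReal_im, I_mul_re,
      I_mul_im, hu, hd]
    have h1 : u.re ^ 2 * lam ^ 2 ≤ u.re ^ 2 * Lam ^ 2 := by gcongr
    have h2 : (B * (Lam / lam)) ^ 2 = Lam ^ 2 * B ^ 2 / lam ^ 2 := by ring
    rw [h2, le_div_iff₀ (by positivity)]
    have h3 : ((u.re + -0 / lam) * (u.re + -0 / lam) + (0 + d.re / lam) * (0 + d.re / lam)) *
        lam ^ 2 = u.re ^ 2 * lam ^ 2 + d.re ^ 2 := by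
      field_simp
      ring
    rw [h3]
    linarith

theorem norm_reflectExt_le {f : ℂ → ℂ} {x ρ lam B : ℝ} (hB : 0 ≤ B) (hlam : 0 ≤ lam)
    (hb : ∀ z ∈ ball (x : ℂ) ρ, 0 ≤ z.im → ‖f z‖ ≤ B * Real.exp (lam * z.im))
    {z : ℂ} (hz : z ∈ ball (x : ℂ) ρ) :
    ‖reflectExt f z‖ ≤ B * Real.exp (lam * dist z x) := by
  have him : |z.im| ≤ dist z x := by
    simpa [Complex.dist_eq] using abs_im_le_norm (z - x)
  suffices ‖reflectExt f z‖ ≤ B * Real.exp (lam * |z.im|) from this.trans (by gcongr)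
  unfold reflectExt
  split_ifs with h
  · rw [abs_of_nonneg h]
    exact hb z hz h
  · rw [not_le] at h
    rw [norm_conj, abs_of_neg h]
    have h1 : conj z ∈ ball (x : ℂ) ρ := by
      rwa [mem_ball, ← dist_conj_conj, conj_conj, conj_ofReal]
    simpa using hb _ h1 (by simpa using h.le)

theorem zeroCount_reflectExt_le {f : ℂ → ℂ} {x r ρ A lam K : ℝ} (hr : 0 < r) (hrρ : 4 / 3 * r < ρ)
    (hA : 0 < A) (hK : 0 ≤ K) (hlam : 0 < lam) (hfx : f x ≠ 0) (hfA : ‖f x‖ ≤ A)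
    (ha : AnalyticOnNhd ℂ (reflectExt f) (ball (x : ℂ) ρ))
    (hb : ∀ z ∈ ball (x : ℂ) ρ, 0 ≤ z.im → ‖f z‖ ≤ A * (1 + K) * Real.exp (lam * z.im)) :
    {z ∈ ball (x : ℂ) r | reflectExt f z = 0}.Finite ∧
      (zeroCount (reflectExt f) (ball (x : ℂ) r) : ℝ) ≤
        4 * (K + 4 / 3 * (lam * r) + Real.log (A / ‖f x‖)) := by
  have hx : reflectExt f x = f x := by simp [reflectExt]
  have hsub : closedBall (x : ℂ) (4 / 3 * r) ⊆ ball (x : ℂ) ρ := closedBall_subset_ball hrρ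
  have hfx' : 0 < ‖f x‖ := norm_pos_iff.2 hfx
  obtain ⟨h1, h2⟩ := zeroCount_ball_le (g := reflectExt f) (c := x) (r := r) (R := 4 / 3 * r)
    (M := A * (1 + K) * Real.exp (lam * (4 / 3 * r))) hr (by linarith) (by positivity)
    (ha.mono hsub) (by rwa [hx]) (fun z hz => by
      have := norm_reflectExt_le (by positivity) hlam.le hb (hsub (sphere_subset_closedBall hz))
      rwa [mem_sphere.1 hz] at this)
  refine ⟨h1, h2.trans ?_⟩
  -- The factor `4` in the conclusion is `1/(1/4)`, from `log (4/3) ≥ 1/4`.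
  have e1 : 4 / 3 * r / r = 4 / 3 := by field_simp
  have e2 : (1 / 4 : ℝ) ≤ Real.log (4 / 3) := by
    have := Real.one_sub_inv_le_log_of_pos (x := 4 / 3) (by norm_num)
    norm_num at this ⊢
    linarith
  have e3 : Real.log (A * (1 + K) * Real.exp (lam * (4 / 3 * r)) / ‖reflectExt f x‖) =
      Real.log (1 + K) + 4 / 3 * (lam * r) + Real.log (A / ‖f x‖) := by
    rw [hx, mul_comm A, mul_right_comm, mul_div_assoc, Real.log_mul (by positivity) (by positivity),
      Real.log_mul (by positivity) (by positivity), Real.log_exp]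
    ring
  have e4 : Real.log (1 + K) ≤ K := by
    linarith [Real.log_le_sub_one_of_pos (x := 1 + K) (by positivity)]
  have e5 : 0 ≤ Real.log (A / ‖f x‖) := Real.log_nonneg (by rwa [one_le_div hfx'])
  have e6 : 0 ≤ lam * r := by positivity
  rw [e1, e3, div_le_iff₀ (by linarith)]
  have : 0 ≤ K + 4 / 3 * (lam * r) + Real.log (A / ‖f x‖) := by positivity
  nlinarith

end LocalBernstein

/-! ### Assembly of the four conclusions -/

open LocalBernstein Complex Set Metric in
theorem mainTheorem2 :
    ∃ C : ℝ, 0 < C ∧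
      ∀ (a b y₀ A lam L : ℝ) (f : ℂ → ℂ),
        a < b → 0 < y₀ → 0 < A → 0 < lam → 0 < L →
        DifferentiableOn ℂ f (LocalBernstein.upperRectangle (Set.Icc a b) y₀) →
        -- (a) lower edge
        (∀ x ∈ Set.Icc a b, (f (x : ℂ)).im = 0 ∧ ‖f (x : ℂ)‖ ≤ A) →
        -- (b) upper edge
        (∀ x ∈ Set.Icc a b,
          ‖f ((x : ℂ) + (y₀ : ℂ) * Complex.I)‖ ≤ A * Real.exp (lam * y₀)) →
        -- (c) vertical edges
        (∀ x ∈ frontier (Set.Icc a b), ∀ y ∈ Set.Icc (0 : ℝ) y₀,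
          ‖f ((x : ℂ) + (y : ℂ) * Complex.I)‖ ≤
            A * Real.exp (lam * y + Real.exp (Real.pi * L / (4 * y₀)))) →
        ∀ x ∈ Set.Icc a b, L ≤ Metric.infDist x (frontier (Set.Icc a b)) →
          -- (i) local Bernstein inequality
          ‖derivWithin f (LocalBernstein.upperRectangle (Set.Icc a b) y₀) (x : ℂ)‖ ≤
            A * lam * (1 + C * Real.exp (-(Real.pi * L / (4 * y₀)))
              + C * (1 / (lam * min y₀ L))) ∧
          -- (ii) local Boas inequality
          ‖f (x : ℂ) + Complex.I *
              derivWithin f (LocalBernstein.upperRectangle (Set.Icc a b) y₀) (x : ℂ)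
                / (lam : ℂ)‖ ≤
            A * (1 + C * Real.exp (-(Real.pi * L / (4 * y₀)))
              + C * (1 / (lam * min y₀ L))) ∧
          -- (iii) local Duffin-Schaeffer inequality
          (∀ y ∈ Set.Icc (0 : ℝ) y₀,
            ‖f ((x : ℂ) + (y : ℂ) * Complex.I)‖ ≤
              A * (1 + C * Real.exp (-(Real.pi * L / (4 * y₀)))) *
                Real.cosh ((1 + C * (1 / (lam * min y₀ L))) * (lam * y))) ∧
          -- (iv) local linear growth of zeroes
          (∀ r : ℝ, 0 < r → r < min y₀ L / 4 → f (x : ℂ) ≠ 0 →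
            AnalyticOnNhd ℂ (LocalBernstein.reflectExt f) (Metric.ball (x : ℂ) r) ∧
            {z ∈ Metric.ball (x : ℂ) r | LocalBernstein.reflectExt f z = 0}.Finite ∧
            (LocalBernstein.zeroCount (LocalBernstein.reflectExt f)
                (Metric.ball (x : ℂ) r) : ℝ) ≤
              C * (1 + lam * r + Real.log (A / ‖f (x : ℂ)‖))) := by
  have hK : 0 < Real.exp 8 := Real.exp_pos 8
  -- Expanding `(1 + e⁸q)(1 + 12t)` with `q ≤ 1` needs `12(1 + e⁸)`; the zero count needs only `4e⁸`
  -- and `16/3`.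
  refine ⟨16 * (1 + Real.exp 8), by positivity, ?_⟩
  intro a b y₀ A lam L f hab hy hA hlam hL hf h0 h1 h2 x hx hdist
  set C : ℝ := 16 * (1 + Real.exp 8) with hC
  rw [frontier_Icc hab.le] at h2 hdist
  have hxa : L ≤ x - a := by
    have := hdist.trans (infDist_le_dist_of_mem (mem_insert a {b}))
    rwa [Real.dist_eq, abs_of_nonneg (by linarith [hx.1])] at this
  have hxb : L ≤ b - x := by
    have := hdist.trans (infDist_le_dist_of_mem (mem_insert_of_mem a (mem_singleton b)))
    rwa [dist_comm, Real.dist_eq, abs_of_nonneg (by linarith [hx.2])] at this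
  set S := upperRectangle (Icc a b) y₀ with hS
  have hSeq : S = Icc a b ×ℂ Icc 0 y₀ := upperRectangle_Icc a b y₀
  have hform : ∀ z : ℂ, (z.re : ℂ) + (z.im : ℂ) * I = z := re_add_im
  have hreal : ∀ z : ℂ, z.re ∈ Icc a b → z.im = 0 → (f z).im = 0 ∧ ‖f z‖ ≤ A := by
    intro z hz hz'
    have := h0 z.re hz
    rwa [show (z.re : ℂ) = z by conv_rhs => rw [← hform z, hz']; simp] at this
  set q : ℝ := Real.exp (-(Real.pi * L / (4 * y₀))) with hq
  have hq0 : 0 < q := Real.exp_pos _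
  have hq1 : q ≤ 1 := Real.exp_le_one_iff.2 (neg_nonpos.2 (by positivity))
  set B : ℝ := A * (1 + Real.exp 8 * q) with hB
  have hB0 : 0 < B := by positivity
  have hAB : A ≤ B := le_mul_of_one_le_right hA.le (by linarith [mul_pos hK hq0])
  have hbound : ∀ z : ℂ, |z.re - x| ≤ L / 3 → z.im ∈ Icc 0 y₀ →
      ‖f z‖ ≤ B * Real.exp (lam * z.im) := by
    intro z hzx hz
    refine norm_le_of_boundary_bounds hab hy hA hL (hSeq ▸ hf) (fun v hv hv' => (hreal v hv hv').2)
      (fun v hv hv' => ?_) (fun v hv hv' => ?_) hxa hxb hzx hz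
    · have := h1 v.re hv
      rwa [← hv', hform, hv'] at this
    · have := h2 v.re (by simpa using hv) v.im hv'
      rwa [hform] at this
  set m : ℝ := min y₀ L with hm
  have hm0 : 0 < m := lt_min hy hL
  set t : ℝ := 1 / (lam * m) with ht
  have ht0 : 0 < t := by positivity
  -- The half-width is `L/3`, where the bound by `B` holds; hence `4/(m/3) = 12λt` below.
  set Lam : ℝ := lam + 4 / min y₀ (L / 3) with hLam
  have hmin : m / 3 ≤ min y₀ (L / 3) :=
    le_min (by linarith [min_le_left y₀ L]) (by linarith [min_le_right y₀ L])
  have hmin0 : 0 < min y₀ (L / 3) := lt_min hy (by positivity)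
  have hLam1 : lam ≤ Lam := le_add_of_nonneg_right (by positivity)
  have hLam2 : Lam ≤ lam * (1 + 12 * t) := by
    have e1 : 4 / min y₀ (L / 3) ≤ 4 / (m / 3) := by gcongr
    have e2 : lam * (1 + 12 * t) = lam + 4 / (m / 3) := by
      rw [ht]; field_simp; ring
    rw [e2, hLam]
    linarith
  have hsub : Icc (x - L / 3) (x + L / 3) ⊆ Icc a b :=
    Icc_subset_Icc (by linarith) (by linarith)
  have himbound : ∀ y ∈ Icc 0 y₀, ∀ ζ, cos ζ = f (x + y * I) / B → |ζ.im| ≤ Lam * y := by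
    intro y hyy ζ hζ
    refine abs_im_le_of_norm_le_mul_exp (by positivity) hy hlam hB0
      (hf.mono fun z hz => hSeq ▸ ⟨hsub hz.1, hz.2⟩)
      (fun z hz hz' => ⟨(hreal z (hsub hz) hz').1, (hreal z (hsub hz) hz').2.trans hAB⟩)
      (fun z hz => hbound z ?_ hz.2) hyy hζ
    have := hz.1
    rw [abs_le]
    constructor <;> linarith [this.1, this.2]
  have hseg : ∀ s ∈ Icc a b, (s : ℂ) ∈ S := fun s hs => by simp [hS, upperRectangle, hs.1, hs.2, hy.le]
  have hd := (hf x (hseg x hx)).hasDerivWithinAt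
  set d := derivWithin f S (x : ℂ) with hdd
  have hdim : d.im = 0 := im_eq_zero_of_hasDerivWithinAt (a := a) (b := b)
    ⟨by linarith, by linarith⟩ hseg hd (fun s hs => (h0 s hs).1)
  have hell := sq_add_sq_le_of_abs_im_le (w := fun z => f z / B) (Lam := Lam) hy
    (fun y hyy => by
      rw [hSeq, mem_reProdIm]
      simpa using ⟨hx, hyy⟩)
    (hd.div_const (B : ℂ)) (by rw [div_ofReal_im, (h0 x hx).1, zero_div]) himbound
  obtain ⟨hbern, hboas⟩ := norm_add_I_mul_div_le hB0 hlam hLam1 (h0 x hx).1 hdim hell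
  have hfac : (1 + Real.exp 8 * q) * (1 + 12 * t) ≤ 1 + C * q + C * t := by
    have e1 : Real.exp 8 * q * t ≤ Real.exp 8 * t := by
      have := mul_le_mul_of_nonneg_left hq1 (mul_pos hK ht0).le
      linarith
    have e2 := mul_pos hK hq0
    have e3 := mul_pos hK ht0
    rw [hC]
    linarith
  refine ⟨?_, ?_, ?_, ?_⟩
  · calc ‖d‖ ≤ B * Lam := hbern
      _ ≤ B * (lam * (1 + 12 * t)) := by gcongr
      _ = A * lam * ((1 + Real.exp 8 * q) * (1 + 12 * t)) := by rw [hB]; ring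
      _ ≤ _ := by gcongr
  · calc _ ≤ B * (Lam / lam) := hboas
      _ ≤ B * (1 + 12 * t) := by
          gcongr
          rwa [div_le_iff₀ hlam, mul_comm]
      _ = A * ((1 + Real.exp 8 * q) * (1 + 12 * t)) := by rw [hB]; ring
      _ ≤ _ := by gcongr
  · intro y hyy
    refine (norm_le_mul_cosh hB0 (himbound y hyy)).trans ?_
    have hy0 := hyy.1
    have e1 : Real.exp 8 ≤ C := by rw [hC]; linarith
    have e2 : 12 ≤ C := by rw [hC]; linarith
    have e3 : Lam * y ≤ (1 + C * t) * (lam * y) := by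
      calc Lam * y ≤ lam * (1 + 12 * t) * y := by gcongr
        _ = (1 + 12 * t) * (lam * y) := by ring
        _ ≤ _ := by gcongr
    have e4 : 0 ≤ Lam * y := mul_nonneg (hlam.le.trans hLam1) hy0
    have e5 : Real.cosh (Lam * y) ≤ Real.cosh ((1 + C * t) * (lam * y)) := by
      rwa [Real.cosh_le_cosh, abs_of_nonneg e4, abs_of_nonneg (e4.trans e3)]
    rw [hB]
    gcongr
  · intro r hr hrm hfx
    -- Radius `m/3` stays in the region of `hbound` and leaves room for Jensen's outer radius
    -- `4r/3`, since `r < m/4`.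
    have hball : ∀ z ∈ ball (x : ℂ) (m / 3), |z.re - x| < m / 3 ∧ |z.im| < m / 3 := by
      intro z hz
      rw [mem_ball, Complex.dist_eq] at hz
      have e1 := (abs_re_le_norm (z - x)).trans_lt hz
      have e2 := (abs_im_le_norm (z - x)).trans_lt hz
      simp only [sub_re, ofReal_re, sub_im, ofReal_im, sub_zero] at e1 e2
      exact ⟨e1, e2⟩
    have hmy : m ≤ y₀ := min_le_left _ _
    have hmL : m ≤ L := min_le_right _ _
    have hballim : ∀ z ∈ ball (x : ℂ) (m / 3), 0 ≤ z.im → z.im ∈ Icc 0 y₀ := fun z hz hzi =>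
      ⟨hzi, by linarith [(abs_lt.1 (hball z hz).2).2]⟩
    have hballre : ∀ z ∈ ball (x : ℂ) (m / 3), z.re ∈ Icc a b := by
      intro z hz
      have := abs_lt.1 (hball z hz).1
      constructor <;> linarith
    have han : AnalyticOnNhd ℂ (reflectExt f) (ball (x : ℂ) (m / 3)) :=
      analyticOnNhd_reflectExt hf
        (fun z hz hzi => hSeq ▸ ⟨hballre z hz, hballim z hz hzi⟩)
        (fun z hz hzi => (hreal z (hballre z hz) hzi).1)
    obtain ⟨hfin, hcount⟩ := zeroCount_reflectExt_le (K := Real.exp 8) hr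
      (by linarith : 4 / 3 * r < m / 3) hA hK.le hlam hfx (h0 x hx).2 han (fun z hz hzi => by
        refine (hbound z (by linarith [(hball z hz).1]) (hballim z hz hzi)).trans ?_
        rw [hB]
        gcongr
        exact mul_le_of_le_one_right hK.le hq1)
    refine ⟨han.mono (ball_subset_ball (by linarith)), hfin, hcount.trans ?_⟩
    have e1 : 0 ≤ Real.log (A / ‖f x‖) :=
      Real.log_nonneg (by rw [one_le_div (norm_pos_iff.2 hfx)]; exact (h0 x hx).2)
    have e2 := mul_pos hlam hr
    have e3 := mul_pos hK e2
    have e4 := mul_nonneg hK.le e1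
    rw [hC]
    nlinarith
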